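/- **Setting (DC model with Gaussian injections).** A power grid is a connected graph on the buses $1,\dots,n$. Each of its $m$ transmission lines is given a fixed but arbitrary orientation $\ell=(i,j)$, and there is at most one line between two distinct buses. The susceptances $\beta_{i,j}=\beta_{j,i}\in\mathbb R$ satisfy $\beta_{i,j}=0$ if there is no line between $i$ and $j$, and the line capacities are $M_\ell>0$. Let $L\in\mathbb R^{n\times n}$ be the weighted Laplacian, $L_{i,j}=-\beta_{i,j}$ for $i\ne j$ and $L_{i,i}=\sum_{k\neq i}\beta_{i,k}$, and let $L^+$ be its Moore–Penrose pseudo-inverse. Let $B\in\mathbb R^{m\times n}$ be the weighted incidence matrix, which for a line $\ell=(i,j)$ has $B_{\ell,i}=\beta_{i,j}$, $B_{\ell,j}=-\beta_{i,j}$ and zeros elsewhere. Put $D=\mathrm{diag}(M_1^{-1},\dots,M_m^{-1})$ and $C=DBL^+$. Bus $n$ is the slack bus: let $S\in\mathbb R^{n\times(n-1)}$ be the identity matrix $I_{n-1}$ with a row of $-1$'s added below it. Let $\mu\in\mathbb R^{n-1}$, let $\Sigma\in\mathbb R^{(n-1)\times(n-1)}$ be a positive semidefinite covariance matrix (possibly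 singular), and let $\sqrt\Sigma$ be any real $(n-1)\times(n-1)$ matrix with $\sqrt\Sigma\sqrt\Sigma^{\,T}=\Sigma$, for example a Cholesky factor. Let $X$ be a standard Gaussian vector in $\mathbb R^{n-1}$. The power injections are $p=S(\sqrt\Sigma X+\mu)$, the phase angles are $\theta=L^+p$, the line flows are $\tilde f_\ell=\beta_{i,j}(\theta_i-\theta_j)$ for $\ell=(i,j)$, and the normalized line flows are $f_\ell=\tilde f_\ell/M_\ell$. The line failure event is $\mathcal L=\{\exists\,\ell:\ |\tilde f_\ell|\ge M_\ell\}$ and the risk level is $r(\mu)=\mathbb E\max_\ell|f_\ell|$. Finally, put $V=CS\sqrt\Sigma$, $W=CS$ and $\sigma_\ell=\bigl(\sum_jV_{\ell,j}^2\bigr)^{1/2}$. (A maximum over the lines is read as $0$ if there is no line, that is, if $n=1$.) **Theorem (Upper bound for line failure probability).** We have $f=VX+W\mu$, the standard deviation of $f_\ell$ is $\sigma_\ell$ for every line $\ell$, $\mathcal L=\{\max_\ell|f_\ell|\ge1\}$, and $\max_\ell|f_\ell|$ is integrable. If $r(\mu)<1$, then $$\mathbb P(\mathcal L)=\mathbb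 P\Bigl(\max_\ell|f_\ell|\ge1\Bigr)\le\exp\Bigl(-\frac{(1-r(\mu))^2}{2\max_\ell\sigma_\ell^2}\Bigr),$$ where the right-hand side is read as $0$ if $\max_\ell\sigma_\ell^2=0$. -/

import Mathlib

open MeasureTheory ProbabilityTheory Matrix

noncomputable section

/-! # Moore-Penrose pseudo-inverse of a real symmetric matrix -/

/-- `B` satisfies the four Penrose equations for the real matrix `A`. -/
structure IsMoorePenroseInverse {m n : Type*} [Fintype m] [Fintype n]
    (A : Matrix m n ℝ) (B : Matrix n m ℝ) : Prop where
  mul_mul_self : A * B * A = A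
  mul_mul_inv : B * A * B = B
  symm_left : (A * B)ᵀ = A * B
  symm_right : (B * A)ᵀ = B * A

/-- The Penrose equations have at most one solution. -/
theorem IsMoorePenroseInverse.unique {m n : Type*} [Fintype m] [Fintype n]
    {A : Matrix m n ℝ} {B C : Matrix n m ℝ}
    (hB : IsMoorePenroseInverse A B) (hC : IsMoorePenroseInverse A C) : B = C := by
  have h1 : A * B = A * C := by
    calc A * B = (A * C * A) * B := by rw [hC.mul_mul_self]
      _ = (A * C) * (A * B) := by simp only [Matrix.mul_assoc]
      _ = ((A * B) * (A * C))ᵀ := by rw [Matrix.transpose_mul, hC.symm_left, hB.symm_left]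
      _ = (A * B * A * C)ᵀ := by simp only [Matrix.mul_assoc]
      _ = A * C := by rw [hB.mul_mul_self, hC.symm_left]
  have h2 : B * A = C * A := by
    calc B * A = B * (A * C * A) := by rw [hC.mul_mul_self]
      _ = (B * A) * (C * A) := by simp only [Matrix.mul_assoc]
      _ = ((C * A) * (B * A))ᵀ := by rw [Matrix.transpose_mul, hC.symm_right, hB.symm_right]
      _ = (C * (A * B * A))ᵀ := by simp only [Matrix.mul_assoc]
      _ = C * A := by rw [hB.mul_mul_self, hC.symm_right]
  calc B = B * A * B := hB.mul_mul_inv.symm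
    _ = C * (A * B) := by rw [h2, Matrix.mul_assoc]
    _ = C * A * C := by rw [h1, Matrix.mul_assoc]
    _ = C := hC.mul_mul_inv

/-- The pseudo-inverse of a real symmetric matrix `A = U diag(d) Uᵀ` (`U` orthogonal):
`U diag(d⁻¹) Uᵀ`, where the zero eigenvalues are left at `0` (in Lean `0⁻¹ = 0`). -/
def symmPinv {n : Type*} [Fintype n] [DecidableEq n] (A : Matrix n n ℝ)
    (hA : A.IsHermitian) : Matrix n n ℝ :=
  (hA.eigenvectorUnitary : Matrix n n ℝ) * diagonal (fun i => (hA.eigenvalues i)⁻¹) *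
    (hA.eigenvectorUnitary : Matrix n n ℝ)ᵀ

/-- `symmPinv` is the Moore-Penrose pseudo-inverse. -/
theorem symmPinv_isMoorePenroseInverse {n : Type*} [Fintype n] [DecidableEq n]
    (A : Matrix n n ℝ) (hA : A.IsHermitian) : IsMoorePenroseInverse A (symmPinv A hA) := by
  set U : Matrix n n ℝ := (hA.eigenvectorUnitary : Matrix n n ℝ) with hU
  set d := hA.eigenvalues with hd
  have hUU : Uᵀ * U = 1 := by
    have := Unitary.coe_star_mul_self hA.eigenvectorUnitary
    simpa [star_eq_conjTranspose, conjTranspose_eq_transpose_of_trivial] using this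
  have hA' : A = U * diagonal d * Uᵀ := by
    have := hA.spectral_theorem
    rw [Unitary.conjStarAlgAut_apply] at this
    simpa [star_eq_conjTranspose, conjTranspose_eq_transpose_of_trivial, Function.comp_def]
      using this
  have hP : symmPinv A hA = U * diagonal (fun i => (d i)⁻¹) * Uᵀ := rfl
  have key : ∀ a b : n → ℝ, (U * diagonal a * Uᵀ) * (U * diagonal b * Uᵀ)
      = U * diagonal (fun i => a i * b i) * Uᵀ := by
    intro a b
    calc _ = U * diagonal a * (Uᵀ * U) * diagonal b * Uᵀ := by simp only [Matrix.mul_assoc]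
      _ = _ := by rw [hUU, Matrix.mul_one, Matrix.mul_assoc U, diagonal_mul_diagonal]
  have tr : ∀ a : n → ℝ, (U * diagonal a * Uᵀ)ᵀ = U * diagonal a * Uᵀ := by
    intro a
    simp [Matrix.transpose_mul, Matrix.mul_assoc]
  rw [hP]
  clear_value U d
  subst hA'
  constructor
  · rw [key, key]
    congr 3
    ext i
    exact mul_inv_mul_cancel (d i)
  · rw [key, key]
    congr 3
    ext i
    by_cases h : d i = 0 <;> simp [h]
  · rw [key, tr]
  · rw [key, tr]

/-! # The grid and its DC approximation -/

/-- A power grid with `N + 1` buses, numbered by `Fin (N + 1)`; the last bus is the slack bus.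
Each transmission line is listed once, with an arbitrary orientation, as a pair of buses. -/
structure PowerGrid (N : ℕ) where
  /-- the (oriented) transmission lines -/
  lines : Finset (Fin (N + 1) × Fin (N + 1))
  /-- a line is listed in one orientation only (in particular there are no loops) -/
  oriented : ∀ i j, (i, j) ∈ lines → (j, i) ∉ lines
  connected : (SimpleGraph.fromRel fun i j => (i, j) ∈ lines).Connected
  /-- the susceptances `β i j` -/
  β : Fin (N + 1) → Fin (N + 1) → ℝ
  β_symm : ∀ i j, β i j = β j i
  β_eq_zero : ∀ i j, (i, j) ∉ lines → (j, i) ∉ lines → β i j = 0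
  /-- the line capacities -/
  M : lines → ℝ
  M_pos : ∀ l, 0 < M l

namespace PowerGrid

variable {N : ℕ} (G : PowerGrid N)

/-- The weighted Laplacian matrix `L`. -/
def laplacian : Matrix (Fin (N + 1)) (Fin (N + 1)) ℝ :=
  Matrix.of fun i j => if i = j then ∑ k ∈ Finset.univ.erase i, G.β i k else -G.β i j

theorem laplacian_isHermitian : G.laplacian.IsHermitian := by
  ext i j
  by_cases h : i = j
  · subst h; simp [laplacian]
  · simp [laplacian, h, Ne.symm h, G.β_symm i j]

/-- The Moore-Penrose pseudo-inverse `L⁺` of the Laplacian. -/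
def laplacianPinv : Matrix (Fin (N + 1)) (Fin (N + 1)) ℝ :=
  symmPinv G.laplacian G.laplacian_isHermitian

/-- The weighted edge-vertex incidence matrix `B`. -/
def incidence : Matrix G.lines (Fin (N + 1)) ℝ :=
  Matrix.of fun l i =>
    if i = l.1.1 then G.β l.1.1 l.1.2 else if i = l.1.2 then -G.β l.1.1 l.1.2 else 0

/-- The diagonal matrix `D` of inverse line capacities. -/
def D : Matrix G.lines G.lines ℝ := diagonal fun l => (G.M l)⁻¹

/-- `C = D B L⁺`, which maps power injections to normalized line flows. -/
def C : Matrix G.lines (Fin (N + 1)) ℝ := G.D * G.incidence * G.laplacianPinv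

/-- The matrix `S`: the identity on the non-slack buses, on top of a row of `-1` for the slack
bus. -/
def S (N : ℕ) : Matrix (Fin (N + 1)) (Fin N) ℝ :=
  Matrix.of fun i j => if i = j.castSucc then 1 else if i = Fin.last N then -1 else 0

/-- Power injections `p = S (R x + μ)`, for a square root `R` of the covariance matrix of the
non-slack injections, their mean `μ`, and a value `x` of the noise. -/
def injection (R : Matrix (Fin N) (Fin N) ℝ) (μ x : Fin N → ℝ) : Fin (N + 1) → ℝ :=
  S N *ᵥ (R *ᵥ x + μ)

/-- The phase angles `θ = L⁺ p`. -/
def phase (p : Fin (N + 1) → ℝ) : Fin (N + 1) → ℝ := G.laplacianPinv *ᵥ p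

/-- The (unnormalized) line flows: `β i j * (θ i - θ j)` on the line `(i, j)`. -/
def rawFlow (p : Fin (N + 1) → ℝ) (l : G.lines) : ℝ :=
  G.β l.1.1 l.1.2 * (G.phase p l.1.1 - G.phase p l.1.2)

/-- The normalized line flows. -/
def flow (p : Fin (N + 1) → ℝ) (l : G.lines) : ℝ := G.rawFlow p l / G.M l

/-- `V = C S R`. -/
def V (R : Matrix (Fin N) (Fin N) ℝ) : Matrix G.lines (Fin N) ℝ := G.C * S N * R

/-- `W = C S`. -/
def W : Matrix G.lines (Fin N) ℝ := G.C * S N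

/-- `σ l = (∑ j, (V l j)²)^(1/2)`. -/
def σ (R : Matrix (Fin N) (Fin N) ℝ) (l : G.lines) : ℝ := √(∑ j, G.V R l j ^ 2)

/-- `max_l (σ l)²`. The index set is finite, so this supremum is a maximum; it is `0` if there is
no line. -/
def maxVar (R : Matrix (Fin N) (Fin N) ℝ) : ℝ := ⨆ l, G.σ R l ^ 2

/-- `max_l |f l|`, with the same convention. -/
def maxFlow (p : Fin (N + 1) → ℝ) : ℝ := ⨆ l, |G.flow p l|

/-- The line failure event: some line carries a flow of at least its capacity. -/
def failure {Ω : Type*} (p : Ω → Fin (N + 1) → ℝ) : Set Ω :=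
  {ω | ∃ l, G.M l ≤ |G.rawFlow (p ω) l|}

/-- The risk level: the expectation of the largest absolute normalized line flow. -/
def riskLevel {Ω : Type*} [MeasurableSpace Ω] (P : Measure Ω) (p : Ω → Fin (N + 1) → ℝ) : ℝ :=
  ∫ ω, G.maxFlow (p ω) ∂P

end PowerGrid

end

/-! The flow `f = V X + W μ` is affine in a standard Gaussian vector, and row `l` of `V` has norm `σ
l`. Hence `max |f l|`, the maximum of the functions `± f l`, is Lipschitz in the noise with constant
`L = max σ l`. The bound is then Gaussian concentration with the sharp constant, at level `1`,
around the mean `r(μ)`.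

Concentration is proved by rotating between independent copies. For smooth `L`-Lipschitz `F`, write
`E[exp(lF(x)) (F(y) - F(x))]` as the integral over `0 ≤ θ ≤ π/2` of the derivative along `cos θ x +
sin θ y`. In the rotated coordinates `(u, v)`, again independent standard Gaussians, `x = cos θ u -
sin θ v`, and integration by parts in `v` (`integral_mul_inner_stdGaussian`) gives `-l sin θ
E[exp(lF(x)) ⟪∇F(x), ∇F(u)⟫]`, which is at least `-l L² sin θ E[exp(lF)]`. As `sin` has integral `1`
over the quarter turn, `E[F exp(lF)] ≤ (E F + l L²) E[exp(lF)]` (`integral_mul_exp_le_stdGaussian`).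
This is a differential inequality for the moment generating function; it integrates to `E[exp(lF)] ≤
exp(l E F + l² L²/2)`, and Chernoff's bound follows. The nonsmooth maximum is reached as a limit of
`softMax`, whose Lipschitz constant is no larger. -/

/-- **Stein's identity** for the standard Gaussian distribution on the real line. -/
theorem integral_mul_id_gaussianReal {g g' : ℝ → ℝ} (hg : ∀ x, HasDerivAt g (g' x) x)
    (h0 : Integrable g (gaussianReal 0 1)) (h1 : Integrable (fun x => g x * x) (gaussianReal 0 1))
    (h2 : Integrable g' (gaussianReal 0 1)) :
    ∫ x, g x * x ∂gaussianReal 0 1 = ∫ x, g' x ∂gaussianReal 0 1 := by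
  have hint : ∀ f : ℝ → ℝ, Integrable f (gaussianReal 0 1) →
      Integrable (fun x => f x * gaussianPDFReal 0 1 x) := by
    intro f hf
    rw [gaussianReal_of_var_ne_zero 0 one_ne_zero,
      integrable_withDensity_iff_integrable_smul' (measurable_gaussianPDF 0 1)
        (ae_of_all _ fun _ => gaussianPDF_lt_top)] at hf
    simpa [mul_comm] using hf
  have hd : ∀ x, HasDerivAt (gaussianPDFReal 0 1) (-(x * gaussianPDFReal 0 1 x)) x := by
    intro x
    have h : HasDerivAt (fun x : ℝ => -(x - 0) ^ 2 / (2 * ((1 : NNReal) : ℝ))) (-x) x := by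
      have := (((hasDerivAt_id x).sub_const 0).pow 2).neg.div_const (2 * ((1 : NNReal) : ℝ))
      convert! this using 1
      simp
      ring
    have := h.exp.const_mul ((√(2 * Real.pi * ((1 : NNReal) : ℝ)))⁻¹)
    convert! this using 1
    simp [gaussianPDFReal]; ring
  -- Integration by parts against the density, whose derivative is `-x` times itself.
  have key := integral_mul_deriv_eq_deriv_mul_of_integrable (u := g) (u' := g')
    (v := gaussianPDFReal 0 1) (v' := fun x => -(x * gaussianPDFReal 0 1 x))
    (fun x _ => hg x) (fun x _ => hd x)
    (by
      refine (hint _ h1).neg.congr (ae_of_all _ fun x => ?_)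
      simp; ring)
    (hint _ h2) (hint _ h0)
  rw [integral_gaussianReal_eq_integral_smul one_ne_zero,
    integral_gaussianReal_eq_integral_smul one_ne_zero]
  simp only [smul_eq_mul]
  have e1 : ∀ x, gaussianPDFReal 0 1 x * (g x * x) = -(g x * -(x * gaussianPDFReal 0 1 x)) := by
    intro x; ring
  simp only [e1]
  rw [integral_neg, key, neg_neg]
  exact integral_congr_ae (ae_of_all _ fun x => mul_comm _ _)

/-! ### Gaussian integration by parts and exponential moments -/

section stdGaussian

variable {E : Type*} [NormedAddCommGroup E] [InnerProductSpace ℝ E] [FiniteDimensional ℝ E]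
  [MeasurableSpace E] [BorelSpace E]

open scoped RealInnerProductSpace

/-- The component of a standard Gaussian vector in the direction of a unit vector can be resampled
independently of the orthogonal component. -/
theorem map_smul_add_orthogonal_stdGaussian {e : E} (he : ‖e‖ = 1) :
    ((gaussianReal 0 1).prod (stdGaussian E)).map
      (fun q : ℝ × E => q.1 • e + (q.2 - ⟪e, q.2⟫ • e)) = stdGaussian E := by
  have hm : Measurable (fun q : ℝ × E => q.1 • e + (q.2 - ⟪e, q.2⟫ • e)) := by fun_prop
  have : IsProbabilityMeasure (((gaussianReal 0 1).prod (stdGaussian E)).map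
      (fun q : ℝ × E => q.1 • e + (q.2 - ⟪e, q.2⟫ • e))) :=
    Measure.isProbabilityMeasure_map hm.aemeasurable
  -- In the exponents of the characteristic functions the two factors contribute `⟪e, t⟫²` and `‖t -
  -- ⟪e, t⟫ • e‖²`, which add up to `‖t‖²` by Pythagoras.
  apply Measure.ext_of_charFun
  ext t
  rw [charFun_apply, integral_map hm.aemeasurable (by fun_prop)]
  have hsplit : ∀ q : ℝ × E,
      Complex.exp (⟪q.1 • e + (q.2 - ⟪e, q.2⟫ • e), t⟫ * Complex.I)
        = Complex.exp (⟪q.1, ⟪e, t⟫⟫ * Complex.I) *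
          Complex.exp (⟪q.2, t - ⟪e, t⟫ • e⟫ * Complex.I) := by
    intro q
    rw [← Complex.exp_add, ← add_mul]
    congr 2
    norm_cast
    simp only [inner_add_left, inner_sub_left, inner_smul_left, inner_sub_right, inner_smul_right,
      real_inner_comm q.2 e]
    simp
    ring
  simp_rw [hsplit]
  rw [integral_prod_mul (fun x : ℝ => Complex.exp (⟪x, ⟪e, t⟫⟫ * Complex.I))
    (fun y : E => Complex.exp (⟪y, t - ⟪e, t⟫ • e⟫ * Complex.I)), ← charFun_apply,
    ← charFun_apply, charFun_stdGaussian, charFun_stdGaussian, charFun_gaussianReal,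
    ← Complex.exp_add]
  congr 1
  have : ‖t - ⟪e, t⟫ • e‖ ^ 2 = ‖t‖ ^ 2 - ⟪e, t⟫ ^ 2 := by
    rw [norm_sub_sq_real, norm_smul, he, inner_smul_right, real_inner_comm]
    simp
    ring
  rw [← Complex.ofReal_pow ‖t - _‖, this]
  push_cast
  ring

/-- Resampling the component along `e` and using Fubini reduces the claim to the one-dimensional
identity on each line parallel to `e`. -/
theorem integral_mul_inner_stdGaussian_of_norm_eq_one {e : E} (he : ‖e‖ = 1) {g : E → ℝ}
    {g' : E → E →L[ℝ] ℝ} (hg : ∀ x, HasFDerivAt g (g' x) x)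
    (h0 : Integrable g (stdGaussian E)) (h1 : Integrable (fun x => g x * ⟪e, x⟫) (stdGaussian E))
    (h2 : Integrable (fun x => g' x e) (stdGaussian E)) :
    ∫ x, g x * ⟪e, x⟫ ∂stdGaussian E = ∫ x, g' x e ∂stdGaussian E := by
  set T : ℝ × E → E := fun q => q.1 • e + (q.2 - ⟪e, q.2⟫ • e) with hT
  have hTm : Measurable T := by fun_prop
  have hmp : MeasurePreserving T ((gaussianReal 0 1).prod (stdGaussian E)) (stdGaussian E) :=
    ⟨hTm, map_smul_add_orthogonal_stdGaussian he⟩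
  have heT : ∀ q, ⟪e, T q⟫ = q.1 := by
    intro q
    simp [hT, inner_add_right, inner_sub_right, inner_smul_right, he]
  have i0 := hmp.integrable_comp_of_integrable h0
  have i1 := hmp.integrable_comp_of_integrable h1
  have i2 := hmp.integrable_comp_of_integrable h2
  have m : ∀ f : E → ℝ, Integrable f (stdGaussian E) →
      ∫ x, f x ∂stdGaussian E = ∫ y, ∫ x, f (T (x, y)) ∂gaussianReal 0 1 ∂stdGaussian E := by
    intro f hf
    refine Eq.trans ?_ (integral_prod_symm _ (hmp.integrable_comp_of_integrable hf))
    conv_lhs => rw [← hmp.map_eq]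
    rw [integral_map hTm.aemeasurable (by rw [hmp.map_eq]; exact hf.1)]
    rfl
  rw [m _ h1, m _ h2]
  apply integral_congr_ae
  filter_upwards [i0.prod_left_ae, i1.prod_left_ae, i2.prod_left_ae] with y j0 j1 j2
  simp only [Function.comp_def, heT] at j0 j1 j2 ⊢
  refine integral_mul_id_gaussianReal (fun x => ?_) j0 j1 j2
  have hd : HasDerivAt (fun x : ℝ => T (x, y)) e x := by
    simpa [hT] using ((hasDerivAt_id x).smul_const e).add_const (y - ⟪e, y⟫ • e)
  exact (hg _).comp_hasDerivAt x hd

/-- **Stein's identity** (Gaussian integration by parts). -/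
theorem integral_mul_inner_stdGaussian (a : E) {g : E → ℝ}
    {g' : E → E →L[ℝ] ℝ} (hg : ∀ x, HasFDerivAt g (g' x) x)
    (h0 : Integrable g (stdGaussian E)) (h1 : Integrable (fun x => g x * ⟪a, x⟫) (stdGaussian E))
    (h2 : Integrable (fun x => g' x a) (stdGaussian E)) :
    ∫ x, g x * ⟪a, x⟫ ∂stdGaussian E = ∫ x, g' x a ∂stdGaussian E := by
  by_cases ha : a = 0
  · simp [ha]
  have hn : ‖a‖ ≠ 0 := norm_ne_zero_iff.2 ha
  obtain ⟨e, he⟩ : ∃ e, e = ‖a‖⁻¹ • a := ⟨_, rfl⟩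
  have hae : a = ‖a‖ • e := by rw [he, smul_inv_smul₀ hn]
  have he1 : ‖e‖ = 1 := by rw [he, norm_smul, norm_inv, norm_norm, inv_mul_cancel₀ hn]
  have key := integral_mul_inner_stdGaussian_of_norm_eq_one he1 hg h0
    ((h1.const_mul ‖a‖⁻¹).congr (ae_of_all _ fun x => by
      simp [he, inner_smul_left]; ring))
    ((h2.const_mul ‖a‖⁻¹).congr (ae_of_all _ fun x => by simp [he]))
  have e1 : ∀ x, g x * ⟪a, x⟫ = ‖a‖ * (g x * ⟪e, x⟫) := by
    intro x
    conv_lhs => rw [hae]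
    simp [inner_smul_left]; ring
  have e2 : ∀ x, g' x a = ‖a‖ * g' x e := by
    intro x
    conv_lhs => rw [hae]
    simp
  simp_rw [e1, e2]
  rw [integral_const_mul, integral_const_mul, key]

theorem integrable_exp_mul_norm_stdGaussian (K : ℝ) :
    Integrable (fun x : E => Real.exp (K * ‖x‖)) (stdGaussian E) := by
  obtain ⟨C, hC, h⟩ := IsGaussian.exists_integrable_exp_sq (stdGaussian E)
  -- Fernique gives a finite `exp (C ‖x‖²)` moment; completing the square yields `K r ≤ C r² + K² /
  -- (4 C)`.
  refine (h.const_mul (Real.exp (K ^ 2 / (4 * C)))).mono' (by fun_prop) (ae_of_all _ fun x => ?_)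
  rw [Real.norm_eq_abs, Real.abs_exp, ← Real.exp_add]
  gcongr
  have : 0 ≤ C * (‖x‖ - K / (2 * C)) ^ 2 := by positivity
  have e : C * (‖x‖ - K / (2 * C)) ^ 2 = K ^ 2 / (4 * C) + C * ‖x‖ ^ 2 - K * ‖x‖ := by
    field_simp; ring
  linarith

end stdGaussian

/-! ### Growth bounds that serve as integrable majorants -/

section growth

variable {E : Type*} [NormedAddCommGroup E] [InnerProductSpace ℝ E]

theorem abs_le_of_norm_fderiv_le {F : E → ℝ} (hF : ContDiff ℝ 1 F) {L : ℝ}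
    (hL : ∀ x, ‖fderiv ℝ F x‖ ≤ L) (x : E) : |F x| ≤ |F 0| + L * ‖x‖ := by
  have := Convex.norm_image_sub_le_of_norm_fderiv_le (𝕜 := ℝ) (f := F) (s := Set.univ)
    (fun x _ => (hF.differentiable one_ne_zero) x) (fun x _ => hL x) convex_univ
    (Set.mem_univ 0) (Set.mem_univ x)
  rw [Real.norm_eq_abs, sub_zero] at this
  have h2 := abs_sub_abs_le_abs_sub (F x) (F 0)
  linarith

theorem exp_mul_le_of_norm_fderiv_le {F : E → ℝ} (hF : ContDiff ℝ 1 F) {L : ℝ}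
    (hL : ∀ x, ‖fderiv ℝ F x‖ ≤ L) (l : ℝ) (x : E) :
    Real.exp (l * F x) ≤ Real.exp (|l| * |F 0|) * Real.exp (|l| * L * ‖x‖) := by
  rw [← Real.exp_add]
  gcongr
  calc l * F x ≤ |l| * |F x| := by rw [← abs_mul]; exact le_abs_self _
    _ ≤ |l| * (|F 0| + L * ‖x‖) := by gcongr; exact abs_le_of_norm_fderiv_le hF hL x
    _ = _ := by ring

/-- The linear factor `‖v‖ ≤ r` is absorbed through `r ≤ exp r`, so that one exponential in `r`
dominates the whole integrand. -/
theorem abs_exp_mul_fderiv_le {F : E → ℝ} (hF : ContDiff ℝ 1 F) {L : ℝ}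
    (hL : ∀ x, ‖fderiv ℝ F x‖ ≤ L) {l : ℝ} {x u v : E} {r : ℝ} (hx : ‖x‖ ≤ r) (hv : ‖v‖ ≤ r) :
    |Real.exp (l * F x) * fderiv ℝ F u v|
      ≤ Real.exp (|l| * |F 0|) * L * Real.exp ((|l| * L + 1) * r) := by
  have hL0 : 0 ≤ L := (norm_nonneg _).trans (hL 0)
  rw [abs_mul, Real.abs_exp]
  have h1 := exp_mul_le_of_norm_fderiv_le hF hL l x
  have h2 : |fderiv ℝ F u v| ≤ L * Real.exp r := by
    have h3 : |fderiv ℝ F u v| ≤ L * ‖v‖ := (fderiv ℝ F u).le_of_opNorm_le (hL u) v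
    refine h3.trans ?_
    gcongr
    have := Real.add_one_le_exp r
    linarith
  calc _ ≤ (Real.exp (|l| * |F 0|) * Real.exp (|l| * L * ‖x‖)) * (L * Real.exp r) := by gcongr
    _ ≤ (Real.exp (|l| * |F 0|) * Real.exp (|l| * L * r)) * (L * Real.exp r) := by gcongr
    _ = _ := by rw [add_mul, one_mul, Real.exp_add]; ring

/-- With a cosine and a sine as coefficients, this gives a majorant that is uniform in the angle. -/
theorem norm_smul_add_smul_le {c s : ℝ} (hc : |c| ≤ 1) (hs : |s| ≤ 1) (u v : E) :
    ‖c • u + s • v‖ ≤ ‖u‖ + ‖v‖ := by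
  refine (norm_add_le _ _).trans ?_
  rw [norm_smul, norm_smul, Real.norm_eq_abs, Real.norm_eq_abs]
  nlinarith [norm_nonneg u, norm_nonneg v]

end growth

/-! ### Decorrelation along the rotation of two independent copies -/

section lipschitz

variable {E : Type*} [NormedAddCommGroup E] [InnerProductSpace ℝ E] [FiniteDimensional ℝ E]
  [MeasurableSpace E] [BorelSpace E]

open scoped RealInnerProductSpace

theorem Continuous.integrable_stdGaussian_of_exp_growth {h : E → ℝ} (hc : Continuous h) {A K : ℝ}
    (hb : ∀ x, |h x| ≤ A * Real.exp (K * ‖x‖)) : Integrable h (stdGaussian E) :=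
  ((integrable_exp_mul_norm_stdGaussian K).const_mul A).mono' hc.aestronglyMeasurable
    (ae_of_all _ hb)

theorem integrable_exp_mul_norm_add_norm_stdGaussian_prod (K : ℝ) :
    Integrable (fun q : E × E => Real.exp (K * (‖q.1‖ + ‖q.2‖)))
      ((stdGaussian E).prod (stdGaussian E)) := by
  have := (integrable_exp_mul_norm_stdGaussian (E := E) K).mul_prod
    (integrable_exp_mul_norm_stdGaussian (E := E) K)
  refine this.congr (ae_of_all _ fun q => ?_)
  simp [mul_add, Real.exp_add]

theorem Continuous.integrable_stdGaussian_prod_of_exp_growth {h : E × E → ℝ} (hc : Continuous h)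
    {A K : ℝ} (hb : ∀ q, |h q| ≤ A * Real.exp (K * (‖q.1‖ + ‖q.2‖))) :
    Integrable h ((stdGaussian E).prod (stdGaussian E)) :=
  ((integrable_exp_mul_norm_add_norm_stdGaussian_prod K).const_mul A).mono' hc.aestronglyMeasurable
    (ae_of_all _ hb)

theorem integrable_exp_mul_of_norm_fderiv_le {F : E → ℝ} (hF : ContDiff ℝ 1 F) {L : ℝ}
    (hL : ∀ x, ‖fderiv ℝ F x‖ ≤ L) (l : ℝ) :
    Integrable (fun x => Real.exp (l * F x)) (stdGaussian E) := by
  have := hF.continuous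
  refine Continuous.integrable_stdGaussian_of_exp_growth (A := Real.exp (|l| * |F 0|))
    (K := |l| * L) (by fun_prop) fun x => ?_
  rw [Real.abs_exp]
  exact exp_mul_le_of_norm_fderiv_le hF hL l x

theorem integrable_of_norm_fderiv_le {F : E → ℝ} (hF : ContDiff ℝ 1 F) {L : ℝ}
    (hL : ∀ x, ‖fderiv ℝ F x‖ ≤ L) : Integrable F (stdGaussian E) := by
  have hL0 : 0 ≤ L := (norm_nonneg _).trans (hL 0)
  refine Continuous.integrable_stdGaussian_of_exp_growth (A := |F 0| + L) (K := 1)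
    hF.continuous fun x => ?_
  have h1 := abs_le_of_norm_fderiv_le hF hL x
  have h2 : ‖x‖ ≤ Real.exp (1 * ‖x‖) := by
    have := Real.add_one_le_exp (1 * ‖x‖); linarith
  have h3 : 1 ≤ Real.exp (1 * ‖x‖) := Real.one_le_exp (by positivity)
  nlinarith [abs_nonneg (F 0)]

theorem measurePreserving_rotation_stdGaussian (θ : ℝ) :
    MeasurePreserving (ContinuousLinearMap.rotation (E := E) θ)
      ((stdGaussian E).prod (stdGaussian E)) ((stdGaussian E).prod (stdGaussian E)) :=
  ⟨by fun_prop, IsGaussian.map_rotation_eq_self_of_forall_strongDual_eq_zero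
    (fun L => integral_strongDual_stdGaussian L) θ⟩

theorem integral_comp_rotation_stdGaussian {h : E × E → ℝ} (hc : Continuous h) (θ : ℝ) :
    ∫ q, h (ContinuousLinearMap.rotation θ q) ∂(stdGaussian E).prod (stdGaussian E)
      = ∫ q, h q ∂(stdGaussian E).prod (stdGaussian E) := by
  have hm := measurePreserving_rotation_stdGaussian (E := E) θ
  conv_rhs => rw [← hm.map_eq]
  rw [integral_map hm.measurable.aemeasurable hc.aestronglyMeasurable]

/-- The rate at which `F (cos θ • x + sin θ • y)` decorrelates from `exp (l * F x)`, for
independent standard Gaussian vectors `x` and `y`. -/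
theorem le_integral_exp_mul_fderiv_rotation {F : E → ℝ} (hF : ContDiff ℝ 1 F) {L : ℝ}
    (hL : ∀ x, ‖fderiv ℝ F x‖ ≤ L) {l : ℝ} (hl : 0 ≤ l) {θ : ℝ} (hθ : 0 ≤ Real.sin θ) :
    -(l * L ^ 2 * ∫ x, Real.exp (l * F x) ∂stdGaussian E) * Real.sin θ ≤
      ∫ q : E × E, Real.exp (l * F q.1) *
        fderiv ℝ F (Real.cos θ • q.1 + Real.sin θ • q.2) (-Real.sin θ • q.1 + Real.cos θ • q.2)
        ∂(stdGaussian E).prod (stdGaussian E) := by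
  have hL0 : 0 ≤ L := (norm_nonneg _).trans (hL 0)
  have hFc := hF.continuous
  have hF' : Continuous (fderiv ℝ F) := hF.continuous_fderiv one_ne_zero
  set c := Real.cos θ with hc
  set s := Real.sin θ with hs
  have hcs : c * c + s * s = 1 := by
    rw [hc, hs]; nlinarith [Real.sin_sq_add_cos_sq θ]
  have hc1 : |c| ≤ 1 := Real.abs_cos_le_one θ
  have hs1 : |-s| ≤ 1 := by rw [abs_neg]; exact Real.abs_sin_le_one θ
  -- `Ψ` and `Φ` are the integrands in rotated coordinates `q = (u, v)`; the original first vector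
  -- is `c • u - s • v`.
  set Ψ : E × E → ℝ := fun q => Real.exp (l * F (c • q.1 + -s • q.2)) with hΨ
  set Φ : E × E → ℝ := fun q => Real.exp (l * F (c • q.1 + -s • q.2)) * fderiv ℝ F q.1 q.2 with hΦ
  have hΨc : Continuous Ψ := by fun_prop
  have hΦc : Continuous Φ := by fun_prop
  have hback : ∀ q : E × E, c • (c • q.1 + s • q.2) + -s • (-s • q.1 + c • q.2) = q.1 := by
    intro q
    have : c • (c • q.1 + s • q.2) + -s • (-s • q.1 + c • q.2) = (c * c + s * s) • q.1 := by
      module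
    rw [this, hcs, one_smul]
  have hΨi : Integrable Ψ ((stdGaussian E).prod (stdGaussian E)) := by
    refine hΨc.integrable_stdGaussian_prod_of_exp_growth
      (A := Real.exp (|l| * |F 0|)) (K := |l| * L) fun q => ?_
    rw [hΨ, Real.abs_exp]
    refine (exp_mul_le_of_norm_fderiv_le hF hL l _).trans ?_
    gcongr
    exact norm_smul_add_smul_le hc1 hs1 _ _
  have hΦi : Integrable Φ ((stdGaussian E).prod (stdGaussian E)) :=
    hΦc.integrable_stdGaussian_prod_of_exp_growth fun q =>
      abs_exp_mul_fderiv_le hF hL (norm_smul_add_smul_le hc1 hs1 _ _)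
        (le_add_of_nonneg_left (norm_nonneg _))
  have e1 : ∫ q : E × E, Real.exp (l * F q.1) * fderiv ℝ F (c • q.1 + s • q.2)
      (-s • q.1 + c • q.2) ∂(stdGaussian E).prod (stdGaussian E)
      = ∫ u, ∫ v, Φ (u, v) ∂stdGaussian E ∂stdGaussian E := by
    rw [← integral_prod _ hΦi, ← integral_comp_rotation_stdGaussian hΦc θ]
    refine integral_congr_ae (ae_of_all _ fun q => ?_)
    simp only [hΦ, ContinuousLinearMap.rotation_apply, ← hc, ← hs, hback]
  have e2 : ∫ x, Real.exp (l * F x) ∂stdGaussian E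
      = ∫ u, ∫ v, Ψ (u, v) ∂stdGaussian E ∂stdGaussian E := by
    rw [← integral_prod _ hΨi, ← integral_comp_rotation_stdGaussian hΨc θ]
    simp only [hΨ, ContinuousLinearMap.rotation_apply, ← hc, ← hs, hback]
    rw [integral_fun_fst (fun x => Real.exp (l * F x))]
    simp
  rw [e1, e2, ← integral_const_mul, ← integral_neg, ← integral_mul_const]
  refine integral_mono_ae ((hΨi.integral_prod_left.const_mul _).neg.mul_const _)
    hΦi.integral_prod_left ?_
  filter_upwards [hΨi.prod_right_ae, hΦi.prod_right_ae] with u hΨu hΦu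
  -- With `u` frozen, `a = ∇F(u)` is a constant vector, so Stein's identity applies in `v`.
  -- Differentiating the exponential brings out the factor `-l s`.
  set a : E := (InnerProductSpace.toDual ℝ E).symm (fderiv ℝ F u) with ha
  have hav : ∀ v, fderiv ℝ F u v = ⟪a, v⟫ := fun v => by
    rw [ha, InnerProductSpace.toDual_symm_apply]
  have han : ‖a‖ ≤ L := by rw [ha, LinearIsometryEquiv.norm_map]; exact hL u
  set g' : E → E →L[ℝ] ℝ := fun v =>
    (Real.exp (l * F (c • u + -s • v)) * l) •
      ((fderiv ℝ F (c • u + -s • v)).comp (-s • ContinuousLinearMap.id ℝ E)) with hg'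
  have hgd : ∀ v, HasFDerivAt (fun v => Real.exp (l * F (c • u + -s • v))) (g' v) v := by
    intro v
    have h1 : HasFDerivAt (fun v : E => c • u + -s • v) (-s • ContinuousLinearMap.id ℝ E) v :=
      ((hasFDerivAt_id v).const_smul (-s)).const_add (c • u)
    have h2 := (((hF.differentiable one_ne_zero _).hasFDerivAt.comp v h1).const_mul l).exp
    convert! h2 using 1
    simp [hg', mul_smul]
  have hg'a : ∀ v, g' v a
      = Real.exp (l * F (c • u + -s • v)) * (l * (-s * fderiv ℝ F (c • u + -s • v) a)) := by
    intro v
    simp [hg']; ring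
  have hFa : ∀ x, |fderiv ℝ F x a| ≤ L ^ 2 := fun x => by
    have : |fderiv ℝ F x a| ≤ L * ‖a‖ := (fderiv ℝ F x).le_of_opNorm_le (hL x) a
    nlinarith
  have hg'i : Integrable (fun v => g' v a) (stdGaussian E) := by
    refine (hΨu.mul_const (l * (s * L ^ 2))).mono' ?_ (ae_of_all _ fun v => ?_)
    · simp_rw [hg'a]
      exact Continuous.aestronglyMeasurable (by fun_prop)
    · rw [hg'a, Real.norm_eq_abs, abs_mul, Real.abs_exp, abs_mul, abs_of_nonneg hl, abs_mul,
        abs_neg, abs_of_nonneg hθ]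
      simp only [hΨ]
      gcongr
      exact hFa _
  have hst := integral_mul_inner_stdGaussian a hgd hΨu
    (hΦu.congr (ae_of_all _ fun v => by simp only [hΦ, hav])) hg'i
  have hst' : ∫ v, Φ (u, v) ∂stdGaussian E = ∫ v, g' v a ∂stdGaussian E := by
    rw [← hst]
    simp only [hΦ, hav]
  rw [hst', ← integral_const_mul, ← integral_neg, ← integral_mul_const]
  refine integral_mono ((hΨu.const_mul _).neg.mul_const _) hg'i fun v => ?_
  simp only [hg'a, hΨ]
  have h1 := (abs_le.1 (hFa (c • u + -s • v))).2
  have h2 : 0 ≤ Real.exp (l * F (c • u + -s • v)) * l * s := by positivity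
  nlinarith [mul_le_mul_of_nonneg_left h1 h2]

end lipschitz

/-! ### Smoothing a maximum of affine functions -/

section softMax

variable {E : Type*} [NormedAddCommGroup E] [InnerProductSpace ℝ E] {ι : Type*} [Fintype ι]

open scoped RealInnerProductSpace

/-- The smooth approximation `β⁻¹ log (∑ i, exp (β fᵢ))` of the maximum of the affine functions
`fᵢ x = ⟪a i, x⟫ + b i`. -/
noncomputable def softMax (a : ι → E) (b : ι → ℝ) (β : ℝ) (x : E) : ℝ :=
  β⁻¹ * Real.log (∑ i, Real.exp (β * (⟪a i, x⟫ + b i)))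

variable [Nonempty ι] (a : ι → E) (b : ι → ℝ)

theorem hasFDerivAt_softMax (β : ℝ) (x : E) :
    HasFDerivAt (softMax a b β)
      (β⁻¹ • (∑ i, Real.exp (β * (⟪a i, x⟫ + b i)))⁻¹ •
        ∑ i, Real.exp (β * (⟪a i, x⟫ + b i)) • β • innerSL ℝ (a i)) x := by
  refine HasFDerivAt.const_mul (HasFDerivAt.log (HasFDerivAt.fun_sum fun i _ =>
    HasFDerivAt.exp (HasFDerivAt.const_mul ?_ β)) ?_) _
  · exact (innerSL ℝ (a i)).hasFDerivAt.add_const (b i)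
  · positivity

theorem contDiff_softMax (β : ℝ) : ContDiff ℝ 1 (softMax a b β) := by
  refine contDiff_const.mul (ContDiff.log (ContDiff.sum fun i _ => ?_) fun x => by positivity)
  exact (contDiff_const.mul ((contDiff_const.inner ℝ contDiff_id).add contDiff_const)).exp

/-- The gradient is a convex combination of the `a i`, with weights proportional to the
exponentials; hence the bound does not depend on `β`. -/
theorem norm_fderiv_softMax_le {β : ℝ} (hβ : 0 < β) {L : ℝ} (hL : ∀ i, ‖a i‖ ≤ L) (x : E) :
    ‖fderiv ℝ (softMax a b β) x‖ ≤ L := by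
  rw [(hasFDerivAt_softMax a b β x).fderiv, norm_smul, norm_smul, Real.norm_of_nonneg (by positivity),
    Real.norm_of_nonneg (by positivity)]
  have hS : 0 < ∑ i, Real.exp (β * (⟪a i, x⟫ + b i)) := by positivity
  calc _ ≤ β⁻¹ * ((∑ i, Real.exp (β * (⟪a i, x⟫ + b i)))⁻¹ *
        ∑ i, Real.exp (β * (⟪a i, x⟫ + b i)) * (β * L)) := by
        gcongr
        refine norm_sum_le_of_le _ fun i _ => ?_
        rw [norm_smul, norm_smul, Real.norm_of_nonneg (Real.exp_pos _).le,
          Real.norm_of_nonneg hβ.le, innerSL_apply_norm]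
        gcongr
        exact hL i
    _ = L := by
        rw [← Finset.sum_mul]
        field_simp

theorem le_softMax {β : ℝ} (hβ : 0 < β) (x : E) : ⨆ i, (⟪a i, x⟫ + b i) ≤ softMax a b β x := by
  refine ciSup_le fun i => ?_
  rw [softMax, inv_mul_eq_div, le_div_iff₀ hβ, Real.le_log_iff_exp_le (by positivity), mul_comm]
  exact Finset.single_le_sum (f := fun i => Real.exp (β * (⟪a i, x⟫ + b i)))
    (fun i _ => (Real.exp_pos _).le) (Finset.mem_univ i)

/-- Each of the `card ι` exponentials is at most the largest one. -/
theorem softMax_le {β : ℝ} (hβ : 0 < β) (x : E) :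
    softMax a b β x ≤ (⨆ i, (⟪a i, x⟫ + b i)) + Real.log (Fintype.card ι) / β := by
  have hc : (0 : ℝ) < Fintype.card ι := by exact_mod_cast Fintype.card_pos
  rw [softMax, inv_mul_eq_div, div_le_iff₀ hβ, Real.log_le_iff_le_exp (by positivity), add_mul,
    div_mul_cancel₀ _ hβ.ne', Real.exp_add, Real.exp_log hc]
  calc _ ≤ ∑ _i : ι, Real.exp ((⨆ i, (⟪a i, x⟫ + b i)) * β) := by
        refine Finset.sum_le_sum fun i _ => ?_
        rw [mul_comm]
        gcongr
        exact le_ciSup (f := fun i => ⟪a i, x⟫ + b i) (Set.finite_range _).bddAbove i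
    _ = _ := by simp [mul_comm]

end softMax

/-! ### From the covariance bound to Gaussian concentration -/

section concentration

variable {E : Type*} [NormedAddCommGroup E] [InnerProductSpace ℝ E] [FiniteDimensional ℝ E]
  [MeasurableSpace E] [BorelSpace E]

open scoped RealInnerProductSpace

theorem integral_exp_mul_sub_stdGaussian_prod {F : E → ℝ} (hF : ContDiff ℝ 1 F) {L : ℝ}
    (hL : ∀ x, ‖fderiv ℝ F x‖ ≤ L) {l : ℝ} (hl : 0 ≤ l) :
    -(l * L ^ 2 * ∫ x, Real.exp (l * F x) ∂stdGaussian E) ≤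
      ∫ q : E × E, Real.exp (l * F q.1) * (F q.2 - F q.1)
        ∂(stdGaussian E).prod (stdGaussian E) := by
  have hFc := hF.continuous
  have hF' : Continuous (fderiv ℝ F) := hF.continuous_fderiv one_ne_zero
  set H := ∫ x, Real.exp (l * F x) ∂stdGaussian E
  set k : E × E → ℝ → ℝ := fun q θ => Real.exp (l * F q.1) *
    fderiv ℝ F (Real.cos θ • q.1 + Real.sin θ • q.2) (-Real.sin θ • q.1 + Real.cos θ • q.2) with hk
  have hkc : Continuous (Function.uncurry k) := by
    simp only [hk, Function.uncurry_def]; fun_prop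
  -- The path runs from `q.1` at angle `0` to `q.2` at angle `π / 2`.
  have hFTC : ∀ q : E × E, Real.exp (l * F q.1) * (F q.2 - F q.1)
      = ∫ θ in (0 : ℝ)..(Real.pi / 2), k q θ := by
    intro q
    have hd : ∀ θ : ℝ, HasDerivAt
        (fun θ : ℝ => Real.exp (l * F q.1) * F (Real.cos θ • q.1 + Real.sin θ • q.2)) (k q θ) θ := by
      intro θ
      have h1 : HasDerivAt (fun θ : ℝ => Real.cos θ • q.1 + Real.sin θ • q.2)
          (-Real.sin θ • q.1 + Real.cos θ • q.2) θ :=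
        ((Real.hasDerivAt_cos θ).smul_const q.1).add ((Real.hasDerivAt_sin θ).smul_const q.2)
      exact ((hF.differentiable one_ne_zero _).hasFDerivAt.comp_hasDerivAt θ h1).const_mul _
    rw [intervalIntegral.integral_eq_sub_of_hasDerivAt (fun θ _ => hd θ)
      ((hkc.uncurry_left q).intervalIntegrable _ _)]
    simp; ring
  have hpi : (0 : ℝ) ≤ Real.pi / 2 := by positivity
  have hki : Integrable (Function.uncurry k) (((stdGaussian E).prod (stdGaussian E)).prod
      (volume.restrict (Set.Ioc 0 (Real.pi / 2)))) := by
    have := ((integrable_exp_mul_norm_add_norm_stdGaussian_prod (E := E) (|l| * L + 1)).const_mul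
      (Real.exp (|l| * |F 0|) * L)).mul_prod
      (integrable_const (μ := volume.restrict (Set.Ioc 0 (Real.pi / 2))) (1 : ℝ))
    refine this.mono' hkc.aestronglyMeasurable (ae_of_all _ fun z => ?_)
    rw [mul_one]
    refine abs_exp_mul_fderiv_le hF hL (le_add_of_nonneg_right (norm_nonneg _))
      (norm_smul_add_smul_le ?_ (Real.abs_cos_le_one _) _ _)
    rw [abs_neg]; exact Real.abs_sin_le_one _
  simp_rw [hFTC, intervalIntegral.integral_of_le hpi]
  rw [integral_integral_swap hki]
  have hsin : ∫ θ in Set.Ioc 0 (Real.pi / 2), -(l * L ^ 2 * H) * Real.sin θ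
      = -(l * L ^ 2 * H) := by
    rw [← intervalIntegral.integral_of_le hpi, intervalIntegral.integral_const_mul, integral_sin]
    simp
  rw [← hsin]
  refine setIntegral_mono_on ?_ hki.integral_prod_right measurableSet_Ioc fun θ hθ =>
    le_integral_exp_mul_fderiv_rotation hF hL hl
      (Real.sin_nonneg_of_nonneg_of_le_pi hθ.1.le (by linarith [hθ.2]))
  exact ((Real.continuous_sin.const_mul _).integrableOn_Icc).mono_set Set.Ioc_subset_Icc_self

/-- **Covariance bound** between a smooth Lipschitz function of a Gaussian vector and its
exponential. -/
theorem integral_mul_exp_le_stdGaussian {F : E → ℝ} (hF : ContDiff ℝ 1 F) {L : ℝ}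
    (hL : ∀ x, ‖fderiv ℝ F x‖ ≤ L) {l : ℝ} (hl : 0 ≤ l) :
    ∫ x, F x * Real.exp (l * F x) ∂stdGaussian E
      ≤ (∫ x, F x ∂stdGaussian E + l * L ^ 2) * ∫ x, Real.exp (l * F x) ∂stdGaussian E := by
  have h1 := integral_exp_mul_sub_stdGaussian_prod hF hL hl
  have hFi := integrable_of_norm_fderiv_le hF hL
  have hEi := integrable_exp_mul_of_norm_fderiv_le hF hL l
  have hFE : Integrable (fun x => F x * Real.exp (l * F x)) (stdGaussian E) := by
    have := integrable_pow_mul_exp_of_mem_interior_integrableExpSet (X := F) (μ := stdGaussian E)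
      (v := l) (by
        have : integrableExpSet F (stdGaussian E) = Set.univ :=
          Set.eq_univ_of_forall fun t => integrable_exp_mul_of_norm_fderiv_le hF hL t
        simp [this]) 1
    simpa using this
  -- The trailing `* 1` makes both terms products of a function of `q.1` and a function of `q.2`.
  have e : ∀ q : E × E, Real.exp (l * F q.1) * (F q.2 - F q.1)
      = Real.exp (l * F q.1) * F q.2 - F q.1 * Real.exp (l * F q.1) * 1 := fun q => by ring
  simp_rw [e] at h1
  rw [integral_sub (hEi.mul_prod hFi) (hFE.mul_prod (integrable_const 1)),
    integral_prod_mul (fun x => Real.exp (l * F x)) F,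
    integral_prod_mul (fun x => F x * Real.exp (l * F x)) (fun _ : E => (1 : ℝ))] at h1
  simp only [integral_const, probReal_univ, smul_eq_mul, mul_one] at h1
  linarith

/-- Sub-Gaussian bound for the moment generating function of a smooth Lipschitz function of a
standard Gaussian vector, with the optimal constant. -/
theorem integral_exp_mul_le_stdGaussian {F : E → ℝ} (hF : ContDiff ℝ 1 F) {L : ℝ}
    (hL : ∀ x, ‖fderiv ℝ F x‖ ≤ L) {l : ℝ} (hl : 0 ≤ l) :
    ∫ x, Real.exp (l * F x) ∂stdGaussian E
      ≤ Real.exp (l * ∫ x, F x ∂stdGaussian E + l ^ 2 * L ^ 2 / 2) := by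
  set m := ∫ x, F x ∂stdGaussian E with hm
  have huniv : integrableExpSet F (stdGaussian E) = Set.univ :=
    Set.eq_univ_of_forall fun t => integrable_exp_mul_of_norm_fderiv_le hF hL t
  -- Ratio of the moment generating function to the claimed bound: it is `1` at `0`, and the
  -- covariance bound says exactly that its derivative is nonpositive for `t > 0`.
  set φ : ℝ → ℝ := fun t => mgf F (stdGaussian E) t * Real.exp (-(t * m + t ^ 2 * L ^ 2 / 2))
    with hφ
  have hd : ∀ t, HasDerivAt φ
      ((∫ x, F x * Real.exp (t * F x) ∂stdGaussian E) *
          Real.exp (-(t * m + t ^ 2 * L ^ 2 / 2)) +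
        mgf F (stdGaussian E) t *
          (Real.exp (-(t * m + t ^ 2 * L ^ 2 / 2)) * -(m + t * L ^ 2))) t := by
    intro t
    refine (hasDerivAt_mgf (by simp [huniv])).mul (HasDerivAt.exp ?_)
    have := (((hasDerivAt_id t).mul_const m).add
      ((((hasDerivAt_id t).pow 2).mul_const (L ^ 2)).div_const 2)).neg
    convert! this using 1
    simp
    ring
  have hanti : AntitoneOn φ (Set.Ici 0) := by
    refine antitoneOn_of_deriv_nonpos (convex_Ici 0)
      (fun t _ => (hd t).continuousAt.continuousWithinAt)
      (fun t _ => (hd t).differentiableAt.differentiableWithinAt) fun t ht => ?_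
    rw [interior_Ici] at ht
    rw [(hd t).deriv]
    have h := integral_mul_exp_le_stdGaussian hF hL (le_of_lt ht)
    have he := Real.exp_pos (-(t * m + t ^ 2 * L ^ 2 / 2))
    simp only [mgf]
    nlinarith
  have h := hanti (Set.mem_Ici.2 le_rfl) (Set.mem_Ici.2 hl) hl
  simp only [hφ, mgf_zero, zero_mul] at h
  simp only [Real.exp_neg] at h
  rw [← div_eq_mul_inv, div_le_iff₀ (Real.exp_pos _)] at h
  simpa [mgf] using h

/-! ### Passage to the nonsmooth maximum -/

section maxAffine

variable {ι : Type*} [Fintype ι]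

theorem measurable_iSup_affine (a : ι → E) (b : ι → ℝ) : Measurable fun x : E => ⨆ i, (⟪a i, x⟫ + b i) :=
  Measurable.iSup fun i => by fun_prop

variable [Nonempty ι] (a : ι → E) (b : ι → ℝ)

theorem integrable_iSup_affine_stdGaussian :
    Integrable (fun x : E => ⨆ i, (⟪a i, x⟫ + b i)) (stdGaussian E) := by
  obtain ⟨L, hL⟩ := (Set.finite_range fun i => ‖a i‖).bddAbove
  have hi := integrable_of_norm_fderiv_le (contDiff_softMax a b 1)
    (norm_fderiv_softMax_le a b one_pos fun i => hL (Set.mem_range_self i))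
  refine integrable_of_le_of_le (measurable_iSup_affine a b).aestronglyMeasurable
    (ae_of_all _ fun x => ?_) (ae_of_all _ (le_softMax a b one_pos))
    (hi.sub (integrable_const (Real.log (Fintype.card ι) / 1))) hi
  exact sub_le_iff_le_add.2 (softMax_le a b one_pos x)

theorem integrable_exp_mul_iSup_affine_stdGaussian {l : ℝ} (hl : 0 ≤ l) :
    Integrable (fun x : E => Real.exp (l * ⨆ i, (⟪a i, x⟫ + b i))) (stdGaussian E) := by
  obtain ⟨L, hL⟩ := (Set.finite_range fun i => ‖a i‖).bddAbove
  refine (integrable_exp_mul_of_norm_fderiv_le (contDiff_softMax a b 1)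
    (norm_fderiv_softMax_le a b one_pos fun i => hL (Set.mem_range_self i)) l).mono'
    ((measurable_iSup_affine a b).const_mul l).exp.aestronglyMeasurable (ae_of_all _ fun x => ?_)
  rw [Real.norm_eq_abs, Real.abs_exp]
  gcongr
  exact le_softMax a b one_pos x

/-- The smooth bound is applied to `softMax` with `β = n + 1`; the error `log (card ι) / β` in the
mean vanishes in the limit. -/
theorem integral_exp_mul_iSup_affine_le {L : ℝ} (hL : ∀ i, ‖a i‖ ≤ L) {l : ℝ} (hl : 0 ≤ l) :
    ∫ x, Real.exp (l * ⨆ i, (⟪a i, x⟫ + b i)) ∂stdGaussian E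
      ≤ Real.exp (l * ∫ x, (⨆ i, (⟪a i, x⟫ + b i)) ∂stdGaussian E + l ^ 2 * L ^ 2 / 2) := by
  have hbd : ∀ n : ℕ, ∫ x, Real.exp (l * ⨆ i, (⟪a i, x⟫ + b i)) ∂stdGaussian E
      ≤ Real.exp (l * (∫ x, (⨆ i, (⟪a i, x⟫ + b i)) ∂stdGaussian E +
        Real.log (Fintype.card ι) / ((n : ℝ) + 1)) + l ^ 2 * L ^ 2 / 2) := by
    intro n
    have hβ : (0 : ℝ) < (n : ℝ) + 1 := by positivity
    have hs := contDiff_softMax a b ((n : ℝ) + 1)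
    have hd := norm_fderiv_softMax_le a b hβ hL
    calc _ ≤ ∫ x, Real.exp (l * softMax a b ((n : ℝ) + 1) x) ∂stdGaussian E := by
          refine integral_mono (integrable_exp_mul_iSup_affine_stdGaussian a b hl)
            (integrable_exp_mul_of_norm_fderiv_le hs hd l) fun x => ?_
          dsimp only
          gcongr
          exact le_softMax a b hβ x
      _ ≤ _ := integral_exp_mul_le_stdGaussian hs hd hl
      _ ≤ _ := by
          gcongr
          calc _ ≤ ∫ x, ((⨆ i, (⟪a i, x⟫ + b i)) + Real.log (Fintype.card ι) / ((n : ℝ) + 1))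
                ∂stdGaussian E :=
                integral_mono (integrable_of_norm_fderiv_le hs hd)
                  ((integrable_iSup_affine_stdGaussian a b).add (integrable_const _))
                  (softMax_le a b hβ)
            _ = _ := by
                rw [integral_add (integrable_iSup_affine_stdGaussian a b) (integrable_const _)]
                simp
  refine ge_of_tendsto' (x := Filter.atTop) ?_ hbd
  have h0 : Filter.Tendsto (fun n : ℕ => Real.log (Fintype.card ι) / ((n : ℝ) + 1)) Filter.atTop
      (nhds 0) := by
    have := tendsto_one_div_add_atTop_nhds_zero_nat (𝕜 := ℝ).const_mul (Real.log (Fintype.card ι))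
    simpa [div_eq_mul_inv] using this
  have := (Real.continuous_exp.tendsto _).comp
    (((h0.const_add (∫ x, (⨆ i, (⟪a i, x⟫ + b i)) ∂stdGaussian E)).const_mul l).add_const
      (l ^ 2 * L ^ 2 / 2))
  simpa [Function.comp_def] using this

/-- **Gaussian concentration** for the maximum of finitely many affine functions. -/
theorem measureReal_le_iSup_affine_le {L : ℝ} (hL0 : 0 < L) (hL : ∀ i, ‖a i‖ ≤ L) {t : ℝ}
    (ht : ∫ x, (⨆ i, (⟪a i, x⟫ + b i)) ∂stdGaussian E ≤ t) :
    (stdGaussian E).real {x | t ≤ ⨆ i, (⟪a i, x⟫ + b i)} ≤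
      Real.exp (-((t - ∫ x, (⨆ i, (⟪a i, x⟫ + b i)) ∂stdGaussian E) ^ 2 / (2 * L ^ 2))) := by
  set m := ∫ x, (⨆ i, (⟪a i, x⟫ + b i)) ∂stdGaussian E
  -- The Chernoff parameter minimizing `-l t + l m + l² L² / 2` is `l = (t - m) / L²`.
  have hl : 0 ≤ (t - m) / L ^ 2 := div_nonneg (sub_nonneg.2 ht) (by positivity)
  refine (measure_ge_le_exp_mul_mgf t hl
    (integrable_exp_mul_iSup_affine_stdGaussian a b hl)).trans ?_
  refine (mul_le_mul_of_nonneg_left (integral_exp_mul_iSup_affine_le a b hL hl)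
    (Real.exp_pos _).le).trans_eq ?_
  rw [← Real.exp_add]
  congr 1
  change _ + ((t - m) / L ^ 2 * m + _) = _
  field_simp
  ring

end maxAffine

end concentration

/-! ### Application to the line flows -/

namespace PowerGrid

variable {N : ℕ} (G : PowerGrid N)

theorem fst_ne_snd (l : G.lines) : l.1.1 ≠ l.1.2 := by
  intro h
  have h1 : (l.1.1, l.1.2) ∈ G.lines := l.2
  have h2 := G.oriented _ _ h1
  rw [h] at h1 h2
  exact h2 h1

theorem incidence_mulVec (θ : Fin (N + 1) → ℝ) (l : G.lines) :
    (G.incidence *ᵥ θ) l = G.β l.1.1 l.1.2 * (θ l.1.1 - θ l.1.2) := by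
  have hne := G.fst_ne_snd l
  have e : ∀ i, G.incidence l i * θ i = (if i = l.1.1 then G.β l.1.1 l.1.2 * θ i else 0) -
      (if i = l.1.2 then G.β l.1.1 l.1.2 * θ i else 0) := by
    intro i
    by_cases h1 : i = l.1.1
    · have h2 : i ≠ l.1.2 := fun h => hne (h1.symm.trans h)
      simp [incidence, h1, hne]
    · by_cases h2 : i = l.1.2 <;> simp [incidence, h1, h2, hne.symm]
  simp only [mulVec, dotProduct, e]
  rw [Finset.sum_sub_distrib]
  simp
  ring

theorem flow_eq_mulVec (p : Fin (N + 1) → ℝ) : G.flow p = G.C *ᵥ p := by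
  ext l
  rw [C, Matrix.mul_assoc, ← mulVec_mulVec, D, mulVec_diagonal, ← mulVec_mulVec,
    incidence_mulVec, flow, rawFlow, phase, div_eq_inv_mul]

theorem flow_injection (R : Matrix (Fin N) (Fin N) ℝ) (μ x : Fin N → ℝ) :
    G.flow (injection R μ x) = G.V R *ᵥ x + G.W *ᵥ μ := by
  rw [flow_eq_mulVec, injection, V, W, mulVec_add, mulVec_add]
  simp only [mulVec_mulVec, Matrix.mul_assoc]

theorem exists_capacity_le_iff (p : Fin (N + 1) → ℝ) :
    (∃ l, G.M l ≤ |G.rawFlow p l|) ↔ 1 ≤ G.maxFlow p := by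
  have h : ∀ l, G.M l ≤ |G.rawFlow p l| ↔ 1 ≤ |G.flow p l| := by
    intro l
    rw [flow, abs_div, abs_of_pos (G.M_pos l), one_le_div (G.M_pos l)]
  simp only [h, maxFlow]
  constructor
  · rintro ⟨l, hl⟩
    exact hl.trans (le_ciSup (f := fun l => |G.flow p l|) (Set.finite_range _).bddAbove l)
  · intro h1
    cases isEmpty_or_nonempty G.lines
    · rw [Real.iSup_of_isEmpty] at h1
      linarith
    · obtain ⟨l, hl⟩ := exists_eq_ciSup_of_finite (f := fun l => |G.flow p l|)
      exact ⟨l, hl ▸ h1⟩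

theorem sq_σ_le_maxVar (R : Matrix (Fin N) (Fin N) ℝ) (l : G.lines) :
    G.σ R l ^ 2 ≤ G.maxVar R :=
  le_ciSup (f := fun l => G.σ R l ^ 2) (Set.finite_range _).bddAbove l

theorem maxVar_nonneg (R : Matrix (Fin N) (Fin N) ℝ) : 0 ≤ G.maxVar R :=
  Real.iSup_nonneg fun _ => sq_nonneg _

theorem norm_toLp_V (R : Matrix (Fin N) (Fin N) ℝ) (l : G.lines) :
    ‖WithLp.toLp 2 (G.V R l)‖ = G.σ R l := by
  simp [EuclideanSpace.norm_eq, σ]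

theorem V_eq_zero_of_maxVar_eq_zero {R : Matrix (Fin N) (Fin N) ℝ} (h : G.maxVar R = 0) :
    G.V R = 0 := by
  ext l j
  have h1 : G.σ R l = 0 := by
    have := G.sq_σ_le_maxVar R l
    rw [h] at this
    exact pow_eq_zero_iff two_ne_zero |>.1 (le_antisymm this (sq_nonneg _))
  rw [← norm_toLp_V, norm_eq_zero] at h1
  have := congrArg (fun v : EuclideanSpace ℝ (Fin N) => v j) h1
  simpa using this

open scoped RealInnerProductSpace

theorem flow_injection_eq_inner (R : Matrix (Fin N) (Fin N) ℝ) (μ : Fin N → ℝ)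
    (x : EuclideanSpace ℝ (Fin N)) (l : G.lines) :
    G.flow (injection R μ x.ofLp) l = ⟪WithLp.toLp 2 (G.V R l), x⟫ + (G.W *ᵥ μ) l := by
  rw [flow_injection, Pi.add_apply]
  congr 1
  simp [mulVec, dotProduct, PiLp.inner_apply, mul_comm]

/-- The coefficient vectors of the signed line flows `f l` and `-f l`, as affine functions of the
noise. -/
noncomputable def signedGradient (R : Matrix (Fin N) (Fin N) ℝ) :
    G.lines ⊕ G.lines → EuclideanSpace ℝ (Fin N) :=
  Sum.elim (fun l => WithLp.toLp 2 (G.V R l)) fun l => -WithLp.toLp 2 (G.V R l)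

/-- The means of the signed line flows `f l` and `-f l`. -/
noncomputable def signedMean (μ : Fin N → ℝ) : G.lines ⊕ G.lines → ℝ :=
  Sum.elim (G.W *ᵥ μ) (-(G.W *ᵥ μ))

theorem norm_signedGradient_le (R : Matrix (Fin N) (Fin N) ℝ) (i : G.lines ⊕ G.lines) :
    ‖G.signedGradient R i‖ ≤ √(G.maxVar R) := by
  refine Real.le_sqrt_of_sq_le ?_
  cases i <;> simp only [signedGradient, Sum.elim_inl, Sum.elim_inr, norm_neg, norm_toLp_V] <;>
    exact G.sq_σ_le_maxVar R _

theorem maxFlow_injection_eq_iSup [Nonempty G.lines] (R : Matrix (Fin N) (Fin N) ℝ)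
    (μ : Fin N → ℝ) (x : EuclideanSpace ℝ (Fin N)) :
    G.maxFlow (injection R μ x.ofLp) = ⨆ i, (⟪G.signedGradient R i, x⟫ + G.signedMean μ i) := by
  have hl : ∀ l, ⟪G.signedGradient R (.inl l), x⟫ + G.signedMean μ (.inl l)
      = G.flow (injection R μ x.ofLp) l := fun l => by
    rw [flow_injection_eq_inner]; rfl
  have hr : ∀ l, ⟪G.signedGradient R (.inr l), x⟫ + G.signedMean μ (.inr l)
      = -G.flow (injection R μ x.ofLp) l := fun l => by
    rw [flow_injection_eq_inner]
    simp [signedGradient, signedMean]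
    ring
  have hb := (Set.finite_range fun i => ⟪G.signedGradient R i, x⟫ + G.signedMean μ i).bddAbove
  have hb' := (Set.finite_range fun l => |G.flow (injection R μ x.ofLp) l|).bddAbove
  apply le_antisymm
  · refine ciSup_le fun l => abs_le'.2 ⟨?_, ?_⟩
    · exact (hl l).symm.le.trans (le_ciSup hb (.inl l))
    · exact (hr l).symm.le.trans (le_ciSup hb (.inr l))
  · refine ciSup_le fun i => ?_
    cases i with
    | inl l => exact (hl l).le.trans ((le_abs_self _).trans (le_ciSup hb' l))
    | inr l => exact (hr l).le.trans ((neg_le_abs _).trans (le_ciSup hb' l))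

theorem maxFlow_of_isEmpty [IsEmpty G.lines] (p : Fin (N + 1) → ℝ) : G.maxFlow p = 0 :=
  Real.iSup_of_isEmpty _

theorem measurable_maxFlow_injection (R : Matrix (Fin N) (Fin N) ℝ) (μ : Fin N → ℝ) :
    Measurable fun x : EuclideanSpace ℝ (Fin N) => G.maxFlow (injection R μ x.ofLp) := by
  cases isEmpty_or_nonempty G.lines
  · simp [maxFlow_of_isEmpty]
  · simp only [maxFlow_injection_eq_iSup]
    exact measurable_iSup_affine _ _

theorem integrable_maxFlow_injection (R : Matrix (Fin N) (Fin N) ℝ) (μ : Fin N → ℝ) :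
    Integrable (fun x : EuclideanSpace ℝ (Fin N) => G.maxFlow (injection R μ x.ofLp))
      (stdGaussian (EuclideanSpace ℝ (Fin N))) := by
  cases isEmpty_or_nonempty G.lines
  · simp [maxFlow_of_isEmpty]
  · simp only [maxFlow_injection_eq_iSup]
    exact integrable_iSup_affine_stdGaussian _ _

theorem measureReal_one_le_maxFlow_le (R : Matrix (Fin N) (Fin N) ℝ) (μ : Fin N → ℝ)
    (hr : ∫ x : EuclideanSpace ℝ (Fin N), G.maxFlow (injection R μ x.ofLp) ∂stdGaussian _ < 1) :
    (stdGaussian (EuclideanSpace ℝ (Fin N))).real {x | 1 ≤ G.maxFlow (injection R μ x.ofLp)} ≤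
      Real.exp (-((1 - ∫ x : EuclideanSpace ℝ (Fin N),
        G.maxFlow (injection R μ x.ofLp) ∂stdGaussian _) ^ 2 / (2 * G.maxVar R))) := by
  rcases (G.maxVar_nonneg R).eq_or_lt with h0 | h0
  · rw [← h0]
    simp
  cases isEmpty_or_nonempty G.lines
  · simp [maxFlow_of_isEmpty, not_le.2 (one_pos (α := ℝ)), Real.exp_nonneg]
  · simp only [maxFlow_injection_eq_iSup] at hr ⊢
    have := measureReal_le_iSup_affine_le (G.signedGradient R) (G.signedMean μ)
      (Real.sqrt_pos.2 h0) (G.norm_signedGradient_le R) hr.le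
    rwa [Real.sq_sqrt h0.le] at this

/-- Here `V = 0`, so the flow is deterministic and its maximum equals the risk level, which is below
`1`. -/
theorem measureReal_one_le_maxFlow_eq_zero {R : Matrix (Fin N) (Fin N) ℝ} (μ : Fin N → ℝ)
    (hr : ∫ x : EuclideanSpace ℝ (Fin N), G.maxFlow (injection R μ x.ofLp) ∂stdGaussian _ < 1)
    (h : G.maxVar R = 0) :
    (stdGaussian (EuclideanSpace ℝ (Fin N))).real {x | 1 ≤ G.maxFlow (injection R μ x.ofLp)}
      = 0 := by
  have e : ∀ x, G.maxFlow (injection R μ x) = ⨆ l, |(G.W *ᵥ μ) l| := fun x => by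
    simp [maxFlow, flow_injection, G.V_eq_zero_of_maxVar_eq_zero h]
  simp only [e, integral_const, probReal_univ, one_smul] at hr ⊢
  simp [not_le.2 hr]

theorem variance_flow_injection (R : Matrix (Fin N) (Fin N) ℝ) (μ : Fin N → ℝ) (l : G.lines) :
    Var[fun x : EuclideanSpace ℝ (Fin N) => G.flow (injection R μ x.ofLp) l; stdGaussian _]
      = G.σ R l ^ 2 := by
  simp only [flow_injection_eq_inner]
  rw [variance_add_const (by fun_prop), ← norm_toLp_V, ← innerSL_apply_norm ℝ,
    ← variance_dual_stdGaussian]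
  rfl

end PowerGrid

theorem theorem1 {N : ℕ} (G : PowerGrid N)
    (Sig R : Matrix (Fin N) (Fin N) ℝ) (hSig : Sig.PosSemidef) (hR : R * Rᵀ = Sig)
    (μ : Fin N → ℝ)
    {Ω : Type*} [MeasurableSpace Ω] (P : Measure Ω) [IsProbabilityMeasure P]
    (X : Ω → EuclideanSpace ℝ (Fin N))
    (hX : HasLaw X (stdGaussian (EuclideanSpace ℝ (Fin N))) P)
    (p : Ω → Fin (N + 1) → ℝ)
    (hp : ∀ ω, p ω = PowerGrid.injection R μ (X ω).ofLp) :
    (∀ ω, G.flow (p ω) = G.V R *ᵥ (X ω).ofLp + G.W *ᵥ μ) ∧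
    (∀ l, Var[fun ω => G.flow (p ω) l; P] = G.σ R l ^ 2) ∧
    G.failure p = {ω | 1 ≤ G.maxFlow (p ω)} ∧
    Integrable (fun ω => G.maxFlow (p ω)) P ∧
    (G.riskLevel P p < 1 →
      P.real (G.failure p) ≤ Real.exp (-((1 - G.riskLevel P p) ^ 2 / (2 * G.maxVar R))) ∧
      (G.maxVar R = 0 → P.real (G.failure p) = 0)) := by
  have hM := G.measurable_maxFlow_injection R μ
  have hfail : G.failure p = {ω | 1 ≤ G.maxFlow (p ω)} := by
    ext ω
    exact G.exists_capacity_le_iff (p ω)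
  have hrisk : G.riskLevel P p = ∫ x : EuclideanSpace ℝ (Fin N),
      G.maxFlow (PowerGrid.injection R μ x.ofLp) ∂stdGaussian _ := by
    simp only [PowerGrid.riskLevel, hp]
    exact hX.integral_comp hM.aestronglyMeasurable
  have hprob : P.real (G.failure p) = (stdGaussian (EuclideanSpace ℝ (Fin N))).real
      {x | 1 ≤ G.maxFlow (PowerGrid.injection R μ x.ofLp)} := by
    rw [hfail, measureReal_def, measureReal_def, ← hX.map_eq,
      Measure.map_apply_of_aemeasurable hX.aemeasurable (measurableSet_le measurable_const hM)]
    simp only [hp]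
    rfl
  refine ⟨fun ω => by rw [hp, G.flow_injection], fun l => ?_, hfail, ?_, fun hr => ?_⟩
  · rw [← G.variance_flow_injection R μ l, ← hX.map_eq, variance_map _ hX.aemeasurable]
    · simp only [hp, Function.comp_def]
    · simp only [G.flow_injection_eq_inner]
      fun_prop
  · have hi := G.integrable_maxFlow_injection R μ
    rw [← hX.map_eq] at hi
    simpa only [hp, Function.comp_def] using hi.comp_aemeasurable hX.aemeasurable
  · rw [hrisk] at hr ⊢
    rw [hprob]
    exact ⟨G.measureReal_one_le_maxFlow_le R μ hr,
      G.measureReal_one_le_maxFlow_eq_zero μ hr⟩
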